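/- Let $X$ be the topological dual of a separable real Banach space $Y$, let $\iota : Y \to X^\star$ be the canonical embedding, and let $Z$ be a real Banach space. Write $t_k \searrow 0$ for a sequence of positive real numbers converging to $0$, and $\stackrel{\star}{\rightharpoonup}$ for weak-$\star$ convergence in $X$. For a subset $S$ of a Banach space $E$, $x\in S$ and $h\in E$ put $$\mathcal R_S(x)=\{h\in E : \exists T>0\ \forall t\in[0,T]:\ x+th\in S\},\qquad \mathcal T_S(x)=\{h\in E:\exists t_k\searrow 0,\ x_k\in S \text{ with } (x_k-x)/t_k\to h\},$$ $$\mathcal T^2_S(x,h)=\{r\in E:\exists t_n\searrow 0 \text{ with } \operatorname{dist}(x+t_nh+\tfrac12t_n^2r,\,S)=o(t_n^2)\}.$$ $S$ is called (outer) second-order regular at $x$ if for all $h\in\mathcal T_S(x)$ and all $x_n=x+t_nh+\frac12t_n^2r_n\in S$ with $t_n\searrow0$ and $t_nr_n\to0$ one has $\operatorname{dist}(r_n,\mathcal T_S^2(x,h))\to0$ (with $\operatorname{dist}(\cdot,\emptyset)=\infty$). For $C\subseteq X$ and $x\in C$ let $\mathcal T^\star_C(x)$ be the set of all $h\in X$ for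 which there are $t_k\searrow 0$ and $x_k\in C$ with $(x_k-x)/t_k\stackrel{\star}{\rightharpoonup}h$, and let $\mathcal N_C^\star(x)=\{x^\star\in\iota(Y):\langle x^\star,h\rangle\le0\ \forall h\in\mathcal T_C^\star(x)\}$. For $\varphi\in-\mathcal N_C^\star(x)$ let $\varphi^\perp=\{h\in X:\langle\varphi,h\rangle=0\}$ and $\mathcal K_C^\star(x,\varphi)=\mathcal T_C^\star(x)\cap\varphi^\perp$, and for $h\in\mathcal K_C^\star(x,\varphi)$ define $$Q_C^{x,\varphi}(h)=\inf\Big\{\liminf_{k\to\infty}\langle\varphi,r_k\rangle : \{r_k\}\subset X,\ t_k\searrow0,\ t_kr_k\stackrel{\star}{\rightharpoonup}0,\ x+t_kh+\tfrac12t_k^2r_k\in C\ \ \forall k\Big\}\in[-\infty,\infty].$$ $C$ satisfies (MRC) in $(x,\varphi)$ if for every $h\in\mathcal K_C^\star(x,\varphi)$ there are $\{r_k\}\subset X$ and $t_k\searrow0$ with $t_kr_k\to0$ in norm, $x+t_kh+\frac12t_k^2r_k\in C$ for all $k$, and $Q_C^{x,\varphi}(h)=\lim_{k\to\infty}\langle\varphi,r_k\rangle$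 (in $[-\infty,\infty]$). **Lemma.** Let $C=G^{-1}(K)$, where $G:X\to Z$ is twice continuously Fréchet differentiable and $K\subseteq Z$ is closed, convex and non-empty. Let $x\in C$ and $\varphi\in-\mathcal N_C^\star(x)$ be such that the Zowe–Kurcyusz constraint qualification $$G'(x)X-\mathcal R_K(G(x))=Z$$ holds, $K$ is second-order regular at $G(x)$, and the maps $h\mapsto G'(x)h$ and $h\mapsto G''(x)h^2:=G''(x)(h,h)$ are weak-$\star$-to-strong sequentially continuous from $X$ to $Z$. Then: 1. $C$ satisfies (MRC) in $(x,\varphi)$; 2. $\mathcal K_C^\star(x,\varphi)=\varphi^\perp\cap G'(x)^{-1}\,\mathcal T_K(G(x))$; 3. for every $h\in\mathcal K_C^\star(x,\varphi)$, $$Q_C^{x,\varphi}(h)=\inf\Big\{\langle\varphi,r\rangle : r\in G'(x)^{-1}\big(\mathcal T_K^2(G(x),G'(x)h)-G''(x)h^2\big)\Big\}.$$ -/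

import Mathlib

open Filter Topology Asymptotics
open scoped Pointwise

noncomputable section

namespace DirCurv

section Strong

variable {E : Type*} [NormedAddCommGroup E] [NormedSpace ℝ E]

/-- `t k ↘ 0`: a sequence of positive reals that converges to `0`. -/
def PosNull (t : ℕ → ℝ) : Prop :=
  (∀ k, 0 < t k) ∧ Tendsto t atTop (𝓝 0)

/-- The radial cone `R_S(x)`. -/
def radialCone (S : Set E) (x : E) : Set E :=
  {h | ∃ T > (0 : ℝ), ∀ t ∈ Set.Icc 0 T, x + t • h ∈ S}

/-- The strong outer tangent cone `T_S(x)`. -/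
def tangentCone (S : Set E) (x : E) : Set E :=
  {h | ∃ (t : ℕ → ℝ) (u : ℕ → E), PosNull t ∧ (∀ k, u k ∈ S) ∧
    Tendsto (fun k => (t k)⁻¹ • (u k - x)) atTop (𝓝 h)}

/-- The strong outer second-order tangent set `T²_S(x, h)`
(of interest for nonempty `S`, `x ∈ S` and `h ∈ T_S(x)`). -/
def secondOrderTangentSet (S : Set E) (x h : E) : Set E :=
  {r | ∃ t : ℕ → ℝ, PosNull t ∧
    (fun n => Metric.infDist (x + t n • h + ((1 / 2 : ℝ) * t n ^ 2) • r) S)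
      =o[atTop] fun n => t n ^ 2}

/-- Outer second-order regularity of `S` at `x`. The distance is the `[0, ∞]`-valued one, so that
the distance to the empty set is `∞`. -/
def IsSecondOrderRegularAt (S : Set E) (x : E) : Prop :=
  ∀ h ∈ tangentCone S x, ∀ (t : ℕ → ℝ) (r : ℕ → E), PosNull t →
    Tendsto (fun n => t n • r n) atTop (𝓝 0) →
    (∀ n, x + t n • h + ((1 / 2 : ℝ) * t n ^ 2) • r n ∈ S) →
    Tendsto (fun n => Metric.infEDist (r n) (secondOrderTangentSet S x h)) atTop (𝓝 0)

end Strong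

section WeakStar

variable {Y : Type*} [NormedAddCommGroup Y] [NormedSpace ℝ Y]

/-- Weak-* convergence of a sequence in the dual `X` of `Y`. -/
def WeakStarTendsto (u : ℕ → StrongDual ℝ Y) (a : StrongDual ℝ Y) : Prop :=
  Tendsto (fun k => StrongDual.toWeakDual (u k)) atTop (𝓝 (StrongDual.toWeakDual a))

/-- The weak-* outer tangent cone `T*_C(x)`. -/
def weakStarTangentCone (C : Set (StrongDual ℝ Y)) (x : StrongDual ℝ Y) :
    Set (StrongDual ℝ Y) :=
  {h | ∃ (t : ℕ → ℝ) (u : ℕ → StrongDual ℝ Y), PosNull t ∧ (∀ k, u k ∈ C) ∧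
    WeakStarTendsto (fun k => (t k)⁻¹ • (u k - x)) h}

/-- The weak-* outer normal cone `N*_C(x)`, a subset of the image of `Y` in its bidual `X*`. -/
def weakStarNormalCone (C : Set (StrongDual ℝ Y)) (x : StrongDual ℝ Y) :
    Set (StrongDual ℝ (StrongDual ℝ Y)) :=
  {ξ | ξ ∈ Set.range (NormedSpace.inclusionInDoubleDual ℝ Y) ∧
    ∀ h ∈ weakStarTangentCone C x, ξ h ≤ 0}

/-- The weak-* critical cone `K*_C(x, φ) = T*_C(x) ∩ φ^⊥`. -/
def weakStarCriticalCone (C : Set (StrongDual ℝ Y)) (x : StrongDual ℝ Y)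
    (φ : StrongDual ℝ (StrongDual ℝ Y)) : Set (StrongDual ℝ Y) :=
  weakStarTangentCone C x ∩ {h | φ h = 0}

/-- The weak-* directional curvature functional `Q_C^{x, φ}` with values in `[-∞, ∞]`
(of interest for `h ∈ K*_C(x, φ)`). -/
def curvatureFunctional (C : Set (StrongDual ℝ Y)) (x : StrongDual ℝ Y)
    (φ : StrongDual ℝ (StrongDual ℝ Y)) (h : StrongDual ℝ Y) : EReal :=
  sInf {q | ∃ (r : ℕ → StrongDual ℝ Y) (t : ℕ → ℝ), PosNull t ∧
    WeakStarTendsto (fun k => t k • r k) 0 ∧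
    (∀ k, x + t k • h + ((1 / 2 : ℝ) * t k ^ 2) • r k ∈ C) ∧
    q = liminf (fun k => ((φ (r k) : ℝ) : EReal)) atTop}

/-- The Mosco regularity condition (MRC) for `C` in `(x, φ)`. -/
def MoscoRegular (C : Set (StrongDual ℝ Y)) (x : StrongDual ℝ Y)
    (φ : StrongDual ℝ (StrongDual ℝ Y)) : Prop :=
  ∀ h ∈ weakStarCriticalCone C x φ, ∃ (r : ℕ → StrongDual ℝ Y) (t : ℕ → ℝ), PosNull t ∧
    Tendsto (fun k => t k • r k) atTop (𝓝 0) ∧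
    (∀ k, x + t k • h + ((1 / 2 : ℝ) * t k ^ 2) • r k ∈ C) ∧
    Tendsto (fun k => ((φ (r k) : ℝ) : EReal)) atTop (𝓝 (curvatureFunctional C x φ h))

end WeakStar

end DirCurv

end

/-! For `h` in the critical cone, feasible parabolas in `C` are compared with the linearized set `R
h` of all `r` with `G'(x) r + G''(x) h²` in the second-order tangent set of `K`.

The Zowe–Kurcyusz condition makes `G u ∈ K` metrically regular (`exists_metricRegular`: Baire, then
a Lyusternik–Graves iteration inside the convex set `K`). An `o(t²)` infeasibility is thus repaired
by an `o(t²)` shift, and each `r ∈ R h` is a norm limit of feasible second-order parts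
(`exists_parabolic_seq`). Hence `Q ≤ φ r`.

Conversely, let `t r` be weak-* null along a feasible parabola. Weak-*-to-strong continuity keeps
the Taylor expansion valid in norm, so the images are parabolas in `K` to which second-order
regularity applies; a norm-null correction then puts `r` into `R h` (`exists_correction`). As `φ` is
norm continuous, `Q ≥ inf φ` over `R h`. A diagonal sequence attains this infimum in norm, which is
(MRC). The first-order version of both steps gives the critical cone. -/

namespace DirCurv

/-! ### Metric regularity from the Zowe–Kurcyusz condition. -/

section Regularity

variable {X : Type*} [NormedAddCommGroup X] [NormedSpace ℝ X]
  {Z : Type*} [NormedAddCommGroup Z] [NormedSpace ℝ Z]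

/-- Approximate form of the generalized open mapping theorem of Zowe and Kurcyusz. -/
theorem exists_ball_subset_closure [CompleteSpace Z] (A : X →L[ℝ] Z) {K : Set Z}
    (hK : Convex ℝ K) {z : Z} (hz : z ∈ K)
    (hA : Set.range A - radialCone K z = Set.univ) :
    ∃ ρ > (0 : ℝ), ρ ≤ 1 ∧ ∀ y, ‖y‖ ≤ ρ → ∀ τ > (0 : ℝ),
      ∃ d k, ‖d‖ ≤ 1 ∧ k ∈ K ∧ ‖k - z‖ ≤ 1 ∧ ‖y - (A d - (k - z))‖ < τ := by
  set D : Set Z := A '' Metric.closedBall 0 1 - (K - {z}) ∩ Metric.closedBall 0 1 with hD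
  have hDconv : Convex ℝ D :=
    ((convex_closedBall 0 1).is_linear_image A.toLinearMap.isLinear).sub
      ((hK.sub (convex_singleton z)).inter (convex_closedBall 0 1))
  have habs : ∀ y : Z, ∃ n : ℕ, 0 < n ∧ (n : ℝ)⁻¹ • y ∈ D := by
    intro y
    have hy : y ∈ Set.range A - radialCone K z := hA ▸ Set.mem_univ y
    obtain ⟨_, ⟨v, rfl⟩, w, ⟨T, hT, hw⟩, rfl⟩ := hy
    obtain ⟨n, hn⟩ := exists_nat_gt (max (max ‖v‖ ‖w‖) T⁻¹)
    obtain ⟨⟨hn1, hn2⟩, hn3⟩ := by simpa only [max_lt_iff] using hn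
    have hn0 : (0 : ℝ) < n := (inv_pos.2 hT).trans hn3
    refine ⟨n, by exact_mod_cast hn0, ?_⟩
    refine ⟨A ((n : ℝ)⁻¹ • v), ⟨_, ?_, rfl⟩, (n : ℝ)⁻¹ • w, ⟨⟨z + (n : ℝ)⁻¹ • w, ?_, z, rfl, ?_⟩, ?_⟩, ?_⟩
    · rw [mem_closedBall_zero_iff, norm_smul, norm_inv, Real.norm_natCast, inv_mul_le_iff₀ hn0]
      linarith
    · exact hw _ ⟨by positivity, (inv_le_comm₀ hT hn0).1 hn3.le⟩
    · simp
    · rw [mem_closedBall_zero_iff, norm_smul, norm_inv, Real.norm_natCast, inv_mul_le_iff₀ hn0]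
      linarith
    · simp [smul_sub]
  -- Baire: since `D` is absorbing, countably many dilates of `closure D` cover `Z`, so one of them
  -- has interior.
  have hU : ⋃ n : ℕ, ((fun y : Z => ((n : ℝ) + 1)⁻¹ • y) ⁻¹' closure D) = Set.univ := by
    refine Set.eq_univ_of_forall fun y => ?_
    obtain ⟨n, hn, hy⟩ := habs y
    obtain ⟨m, rfl⟩ := Nat.exists_eq_succ_of_ne_zero hn.ne'
    refine Set.mem_iUnion.2 ⟨m, subset_closure ?_⟩
    simpa using hy
  obtain ⟨n, y₁, hy₁⟩ := nonempty_interior_of_iUnion_of_closed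
    (fun n => isClosed_closure.preimage (continuous_const_smul _)) hU
  have hn : ((n : ℝ) + 1)⁻¹ ≠ 0 := by positivity
  have hy₀ : ((n : ℝ) + 1)⁻¹ • y₁ ∈ interior (closure D) :=
    (isOpenMap_smul₀ hn).interior_preimage_subset_preimage_interior hy₁
  set y₀ := ((n : ℝ) + 1)⁻¹ • y₁
  obtain ⟨m, hm, hmy⟩ := habs (-y₀)
  have hm' : (0 : ℝ) < m := by exact_mod_cast hm
  -- The weights make `0` a convex combination of the interior point `y₀` and the point `-y₀ / m` of
  -- `D`.
  have h0 : (0 : Z) ∈ interior (closure D) := by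
    refine hDconv.closure.combo_interior_self_subset_interior (a := 1 / (1 + m : ℝ))
      (b := m / (1 + m : ℝ)) (by positivity) (by positivity) (by field_simp)
      ⟨_, ⟨y₀, hy₀, rfl⟩, _, ⟨_, subset_closure hmy, rfl⟩, ?_⟩
    simp only [smul_smul, smul_neg]
    rw [show (m : ℝ) / (1 + m) * (m : ℝ)⁻¹ = 1 / (1 + m) by field_simp]
    simp
  obtain ⟨ε, hε, hball⟩ := Metric.nhds_basis_closedBall.mem_iff.1 (mem_interior_iff_mem_nhds.1 h0)
  refine ⟨min ε 1, by positivity, min_le_right _ _, fun y hy τ hτ => ?_⟩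
  have hyD : y ∈ closure D := hball (by simpa using hy.trans (min_le_left _ _))
  obtain ⟨_, ⟨_, ⟨d, hd, rfl⟩, _, ⟨⟨k, hk, z', rfl, rfl⟩, hk1⟩, rfl⟩, hlt⟩ :=
    Metric.mem_closure_iff.1 hyD τ hτ
  exact ⟨d, k, by simpa using hd, hk, by simpa using hk1, by simpa [dist_eq_norm] using hlt⟩

/-- A Lyusternik–Graves iteration with values in a closed convex set. -/
theorem exists_mem_of_approximatesLinearOn [CompleteSpace X] [CompleteSpace Z] {A : X →L[ℝ] Z}
    {K : Set Z} (hKc : IsClosed K) (hK : Convex ℝ K) {z : Z} {ρ : ℝ} (hρ : 0 < ρ) (hρ1 : ρ ≤ 1)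
    (hA : ∀ y, ‖y‖ ≤ ρ → ∀ τ > (0 : ℝ),
      ∃ d k, ‖d‖ ≤ 1 ∧ k ∈ K ∧ ‖k - z‖ ≤ 1 ∧ ‖y - (A d - (k - z))‖ < τ)
    {F : X → Z} {s : Set X} {η : NNReal} (hη : (η : ℝ) ≤ ρ / 8) (hF : ApproximatesLinearOn F A s η)
    (hFc : Continuous F) {u₀ : X} {k₀ : Z} (hk₀ : k₀ ∈ K) (hk₀z : ‖k₀ - z‖ ≤ ρ / 4)
    (he : ‖F u₀ - k₀‖ ≤ ρ ^ 2 / 32)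
    (hs : Metric.closedBall u₀ (4 / ρ * ‖F u₀ - k₀‖) ⊆ s) :
    ∃ u, F u ∈ K ∧ ‖u - u₀‖ ≤ 4 / ρ * ‖F u₀ - k₀‖ := by
  set e := ‖F u₀ - k₀‖ with hedef
  have he0 : 0 ≤ e := norm_nonneg _
  -- one step of the linearized problem
  have step : ∀ (y k₁ : Z), k₁ ∈ K → ‖k₁ - z‖ ≤ ρ / 2 → ‖y‖ ≤ ρ / 2 →
      ∃ d k, ‖d‖ ≤ 2 / ρ * ‖y‖ ∧ k ∈ K ∧ ‖k - k₁‖ ≤ 4 / ρ * ‖y‖ ∧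
        ‖y - (A d - (k - k₁))‖ ≤ ‖y‖ / 4 := by
    intro y k₁ hk₁ hk₁z hy
    rcases eq_or_ne y 0 with rfl | hy0
    · exact ⟨0, k₁, by simp, hk₁, by simp, by simp⟩
    have hyp : 0 < ‖y‖ := norm_pos_iff.2 hy0
    -- With this scale `l⁻¹ • y` has norm `ρ / 2`, which leaves `ρ / 2` for moving the base point
    -- from `z` to `k₁`; the tolerance `ρ / 8` scales back to `‖y‖ / 4`.
    set l := 2 / ρ * ‖y‖ with hl
    have hl0 : 0 < l := by positivity
    have hl1 : l ≤ 1 := by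
      rw [hl, div_mul_eq_mul_div, div_le_one hρ]; linarith
    obtain ⟨d, k, hd, hk, hkz, hlt⟩ := hA (l⁻¹ • y - (k₁ - z)) (by
      refine (norm_sub_le _ _).trans ?_
      have : ‖l⁻¹ • y‖ = ρ / 2 := by
        rw [norm_smul, norm_inv, Real.norm_of_nonneg hl0.le, hl]; field_simp
      linarith) (ρ / 8) (by positivity)
    refine ⟨l • d, k₁ + l • (k - k₁), ?_, hK.add_smul_sub_mem hk₁ hk ⟨hl0.le, hl1⟩, ?_, ?_⟩
    · rw [norm_smul, Real.norm_of_nonneg hl0.le]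
      exact mul_le_of_le_one_right hl0.le hd
    · rw [add_sub_cancel_left, norm_smul, Real.norm_of_nonneg hl0.le]
      have h2 : ‖k - k₁‖ ≤ 2 := by
        have := norm_sub_le_norm_sub_add_norm_sub k z k₁
        rw [norm_sub_rev z k₁] at this
        linarith
      calc l * ‖k - k₁‖ ≤ l * 2 := by gcongr
        _ = 4 / ρ * ‖y‖ := by rw [hl]; ring
    · have : y - (A (l • d) - (k₁ + l • (k - k₁) - k₁))
          = l • (l⁻¹ • y - (k₁ - z) - (A d - (k - z))) := by
        simp only [map_smul, smul_sub, smul_inv_smul₀ hl0.ne']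
        abel
      rw [this, norm_smul, Real.norm_of_nonneg hl0.le]
      calc l * _ ≤ l * (ρ / 8) := by gcongr
        _ = ‖y‖ / 4 := by rw [hl]; field_simp; norm_num
  -- the invariant of the iteration
  let P : ℕ → X × Z → Prop := fun n p => p.2 ∈ K ∧ ‖F p.1 - p.2‖ ≤ e * (1 / 2) ^ n ∧
    ‖p.1 - u₀‖ ≤ 4 / ρ * e * (1 - (1 / 2) ^ n) ∧ ‖p.2 - k₀‖ ≤ 8 / ρ * e * (1 - (1 / 2) ^ n)
  have next : ∀ n p, P n p → ∃ q, P (n + 1) q ∧ ‖q.1 - p.1‖ ≤ 2 / ρ * e * (1 / 2) ^ n ∧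
      ‖q.2 - p.2‖ ≤ 4 / ρ * e * (1 / 2) ^ n := by
    rintro n ⟨u, k⟩ ⟨hk, hres, hu, hkk⟩
    dsimp only at hk hres hu hkk
    have hpow : (0 : ℝ) < (1 / 2) ^ n := by positivity
    have hpow1 : ((1 : ℝ) / 2) ^ n ≤ 1 := pow_le_one₀ (by norm_num) (by norm_num)
    -- The bound `ρ ^ 2 / 32` on the initial residual limits the total drift in `K` to `ρ / 4`, so
    -- every iterate stays within `ρ / 2` of `z`.
    have he' : 8 / ρ * e ≤ ρ / 4 := by
      calc 8 / ρ * e ≤ 8 / ρ * (ρ ^ 2 / 32) := by gcongr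
        _ = ρ / 4 := by field_simp; norm_num
    have hee : e ≤ ρ / 2 := by nlinarith
    have hkz : ‖k - z‖ ≤ ρ / 2 := by
      have h1 := norm_sub_le_norm_sub_add_norm_sub k k₀ z
      have h2 : 8 / ρ * e * (1 - (1 / 2) ^ n) ≤ 8 / ρ * e :=
        mul_le_of_le_one_right (by positivity) (by linarith)
      linarith
    have hres' : ‖k - F u‖ ≤ e * (1 / 2) ^ n := by rwa [norm_sub_rev]
    obtain ⟨d, k', hd, hk', hkk', hlt⟩ := step (k - F u) k hk hkz
      (hres'.trans ((mul_le_of_le_one_right he0 hpow1).trans hee))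
    have hd' : ‖d‖ ≤ 2 / ρ * e * (1 / 2) ^ n := by
      rw [mul_assoc]; exact hd.trans (by gcongr)
    have hkk'' : ‖k' - k‖ ≤ 4 / ρ * e * (1 / 2) ^ n := by
      rw [mul_assoc]; exact hkk'.trans (by gcongr)
    have hun : ‖u + d - u₀‖ ≤ 4 / ρ * e * (1 - (1 / 2) ^ (n + 1)) := by
      calc ‖u + d - u₀‖ = ‖(u - u₀) + d‖ := by congr 1; abel
        _ ≤ _ := norm_add_le _ _
        _ ≤ 4 / ρ * e * (1 - (1 / 2) ^ n) + 2 / ρ * e * (1 / 2) ^ n := add_le_add hu hd'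
        _ = _ := by ring
    have hmem : ∀ w : X, ∀ j : ℕ, ‖w - u₀‖ ≤ 4 / ρ * e * (1 - (1 / 2) ^ j) → w ∈ s := by
      intro w j hw
      refine hs (mem_closedBall_iff_norm.2 (hw.trans
        (mul_le_of_le_one_right (by positivity) ?_)))
      have : (0 : ℝ) < (1 / 2) ^ j := by positivity
      linarith
    refine ⟨(u + d, k'), ⟨hk', ?_, hun, ?_⟩, by simpa using hd', hkk''⟩
    · have h1 := hF (u + d) (hmem _ _ hun) u (hmem _ _ hu)
      rw [add_sub_cancel_left] at h1
      -- Nonlinearity and the inexact linear solve each cost a quarter of the residual bound, so the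
      -- bound halves.
      have h2 : (η : ℝ) * ‖d‖ ≤ e * (1 / 2) ^ n / 4 := by
        calc (η : ℝ) * ‖d‖ ≤ ρ / 8 * (2 / ρ * e * (1 / 2) ^ n) := by gcongr
          _ = _ := by field_simp; ring
      calc ‖F (u + d) - k'‖ = ‖(F (u + d) - F u - A d) - (k - F u - (A d - (k' - k)))‖ := by
            congr 1; abel
        _ ≤ _ := norm_sub_le _ _
        _ ≤ e * (1 / 2) ^ n / 4 + e * (1 / 2) ^ n / 4 := by
            refine add_le_add (h1.trans h2) (hlt.trans ?_)
            gcongr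
        _ = _ := by ring
    · calc ‖k' - k₀‖ ≤ ‖k' - k‖ + ‖k - k₀‖ := norm_sub_le_norm_sub_add_norm_sub _ _ _
        _ ≤ 4 / ρ * e * (1 / 2) ^ n + 8 / ρ * e * (1 - (1 / 2) ^ n) := add_le_add hkk'' hkk
        _ = _ := by ring
  choose! g hg using next
  let q : ℕ → X × Z := fun n => Nat.rec (u₀, k₀) (fun n p => g n p) n
  have hq : ∀ n, P n (q n) := by
    intro n
    induction n with
    | zero => exact ⟨hk₀, by simp [q, hedef], by simp [q], by simp [q]⟩
    | succ n ih => exact (hg n _ ih).1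
  have hq1 : ∀ n, dist (q n).1 (q (n + 1)).1 ≤ 2 / ρ * e * (1 / 2) ^ n := fun n => by
    rw [dist_comm, dist_eq_norm]; exact (hg n _ (hq n)).2.1
  have hq2 : ∀ n, dist (q n).2 (q (n + 1)).2 ≤ 4 / ρ * e * (1 / 2) ^ n := fun n => by
    rw [dist_comm, dist_eq_norm]; exact (hg n _ (hq n)).2.2
  obtain ⟨u, hu⟩ := cauchySeq_tendsto_of_complete
    (cauchySeq_of_le_geometric _ _ (by norm_num) hq1)
  obtain ⟨k, hk⟩ := cauchySeq_tendsto_of_complete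
    (cauchySeq_of_le_geometric _ _ (by norm_num) hq2)
  have hkK : k ∈ K := hKc.mem_of_tendsto hk (Eventually.of_forall fun n => (hq n).1)
  have hlim : Tendsto (fun n => F (q n).1 - (q n).2) atTop (𝓝 (F u - k)) :=
    ((hFc.tendsto u).comp hu).sub hk
  have hlim0 : Tendsto (fun n => F (q n).1 - (q n).2) atTop (𝓝 0) := by
    refine squeeze_zero_norm (fun n => (hq n).2.1) ?_
    simpa using (tendsto_pow_atTop_nhds_zero_of_lt_one (r := (1 / 2 : ℝ)) (by norm_num)
      (by norm_num)).const_mul e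
  refine ⟨u, ?_, ?_⟩
  · rw [sub_eq_zero.1 (tendsto_nhds_unique hlim hlim0)]
    exact hkK
  · refine le_of_tendsto ((hu.sub_const u₀).norm) (Eventually.of_forall fun n => ?_)
    refine (hq n).2.2.1.trans (mul_le_of_le_one_right (by positivity) ?_)
    have : (0 : ℝ) < (1 / 2) ^ n := by positivity
    linarith

/-- Metric regularity of the constraint `G u ∈ K` under the Zowe–Kurcyusz condition. -/
theorem exists_metricRegular [CompleteSpace X] [CompleteSpace Z] {G : X → Z} (hGc : Continuous G)
    {A : X →L[ℝ] Z} {x : X} (hG : HasStrictFDerivAt G A x) {K : Set Z} (hKc : IsClosed K)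
    (hK : Convex ℝ K) (hx : G x ∈ K) (hA : Set.range A - radialCone K (G x) = Set.univ) :
    ∃ c > (0 : ℝ), ∀ᶠ p : X × Z in 𝓝 (x, G x), p.2 ∈ K →
      ∃ u, G u ∈ K ∧ ‖u - p.1‖ ≤ c * ‖G p.1 - p.2‖ := by
  obtain ⟨ρ, hρ, hρ1, hopen⟩ := exists_ball_subset_closure A hK hx hA
  obtain ⟨s, hs, hsG⟩ := hG.approximates_deriv_on_nhds (c := (ρ / 8).toNNReal)
    (Or.inr (Real.toNNReal_pos.2 (by positivity)))
  obtain ⟨δ, hδ, hδs⟩ := Metric.mem_nhds_iff.1 hs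
  refine ⟨4 / ρ, by positivity, ?_⟩
  have hres : Tendsto (fun p : X × Z => ‖G p.1 - p.2‖) (𝓝 (x, G x)) (𝓝 0) := by
    have : Continuous fun p : X × Z => ‖G p.1 - p.2‖ := by fun_prop
    simpa using this.tendsto (x, G x)
  have hbd : Tendsto (fun p : X × Z => ‖p.1 - x‖ + 4 / ρ * ‖G p.1 - p.2‖) (𝓝 (x, G x)) (𝓝 0) := by
    have : Continuous fun p : X × Z => ‖p.1 - x‖ + 4 / ρ * ‖G p.1 - p.2‖ := by fun_prop
    simpa using this.tendsto (x, G x)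
  have hkz : Tendsto (fun p : X × Z => ‖p.2 - G x‖) (𝓝 (x, G x)) (𝓝 0) := by
    have : Continuous fun p : X × Z => ‖p.2 - G x‖ := by fun_prop
    simpa using this.tendsto (x, G x)
  filter_upwards [hres.eventually_le_const (show 0 < ρ ^ 2 / 32 by positivity),
    hbd.eventually_lt_const hδ, hkz.eventually_le_const (show 0 < ρ / 4 by positivity)]
    with p h1 h2 h3 hp
  refine exists_mem_of_approximatesLinearOn hKc hK hρ hρ1 hopen
    (Real.coe_toNNReal _ (by positivity)).le hsG hGc hp h3 h1 ?_
  intro w hw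
  refine hδs (mem_ball_iff_norm.2 ?_)
  have := norm_sub_le_norm_sub_add_norm_sub w p.1 x
  have := mem_closedBall_iff_norm.1 hw
  linarith

/-- The generalized open mapping theorem of Zowe and Kurcyusz. -/
theorem exists_add_map_add_mem [CompleteSpace X] [CompleteSpace Z]
    {A : X →L[ℝ] Z} {K : Set Z} (hKc : IsClosed K)
    (hK : Convex ℝ K) {z : Z} (hz : z ∈ K) (hA : Set.range A - radialCone K z = Set.univ) :
    ∃ c > (0 : ℝ), ∃ δ > (0 : ℝ), ∀ y : Z, ‖y‖ ≤ δ → ∃ d, ‖d‖ ≤ c * ‖y‖ ∧ z + (A d + y) ∈ K := by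
  obtain ⟨ρ, hρ, hρ1, hopen⟩ := exists_ball_subset_closure A hK hz hA
  refine ⟨4 / ρ, by positivity, ρ ^ 2 / 32, by positivity, fun y hy => ?_⟩
  -- The map is affine with linear part `A`, so the iteration runs with `η = 0` on the whole space.
  obtain ⟨u, hu, hu'⟩ := exists_mem_of_approximatesLinearOn (F := fun u => z + (A u + y)) (η := 0)
    (s := Set.univ) (u₀ := 0) hKc hK hρ hρ1 hopen (by simpa using by positivity)
    (by intro a _ b _; simp) (by fun_prop) hz (by simpa using by positivity) (by simpa using hy)
    (Set.subset_univ _)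
  exact ⟨u, by simpa using hu', hu⟩

end Regularity

/-! ### Second-order expansions and tangent sets. -/

section Expansion

variable {X : Type*} [NormedAddCommGroup X] [NormedSpace ℝ X]
  {Z : Type*} [NormedAddCommGroup Z] [NormedSpace ℝ Z]

/-- Metric regularity turns approximate feasibility of order `o(s n)` into feasibility after a
correction of order `o(s n)`. -/
theorem exists_seq_map_mem {G : X → Z} {x : X} {K : Set Z} {c : ℝ}
    (hreg : ∀ᶠ p : X × Z in 𝓝 (x, G x), p.2 ∈ K → ∃ u, G u ∈ K ∧ ‖u - p.1‖ ≤ c * ‖G p.1 - p.2‖)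
    {p : ℕ → X} {k : ℕ → Z} {s : ℕ → ℝ} (hp : Tendsto p atTop (𝓝 x)) (hkK : ∀ᶠ n in atTop, k n ∈ K)
    (hk : Tendsto k atTop (𝓝 (G x)))
    (h : Tendsto (fun n => (s n)⁻¹ • (G (p n) - k n)) atTop (𝓝 0)) :
    ∃ q : ℕ → X, (∀ᶠ n in atTop, G (q n) ∈ K) ∧
      Tendsto (fun n => (s n)⁻¹ • (q n - p n)) atTop (𝓝 0) := by
  have hev : ∀ᶠ n in atTop, ∃ u, G u ∈ K ∧ ‖u - p n‖ ≤ c * ‖G (p n) - k n‖ :=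
    ((hp.prodMk_nhds hk).eventually hreg).mp (hkK.mono fun n hn h => h hn)
  obtain ⟨q, hq⟩ := hev.choice
  refine ⟨q, hq.mono fun n hn => hn.1, ?_⟩
  refine squeeze_zero_norm' (a := fun n => c * ‖(s n)⁻¹ • (G (p n) - k n)‖)
    (hq.mono fun n hn => ?_) (by simpa using h.norm.const_mul c)
  rw [norm_smul, norm_smul, mul_left_comm]
  exact mul_le_mul_of_nonneg_left hn.2 (norm_nonneg _)

/-- Second-order Taylor expansion with Peano remainder. -/
theorem isLittleO_taylor_two {G : X → Z} (hG : ContDiff ℝ 2 G) (x : X) :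
    (fun v => G (x + v) - G x - fderiv ℝ G x v - (1 / 2 : ℝ) • fderiv ℝ (fderiv ℝ G) x v v)
      =o[𝓝 0] fun v => ‖v‖ ^ 2 := by
  have hG1 : Differentiable ℝ G := hG.differentiable (by norm_num)
  have hG2 : Differentiable ℝ (fderiv ℝ G) :=
    (hG.fderiv_right (m := 1) (by norm_num)).differentiable (by norm_num)
  set B := fderiv ℝ (fderiv ℝ G) x with hB
  have hsymm : ∀ v w, B v w = B w v :=
    second_derivative_symmetric (fun y => (hG1 y).hasFDerivAt) (hG2 x).hasFDerivAt
  -- By symmetry of `B`, the derivative of this remainder is the first-order remainder of `fderiv ℝ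
  -- G`, hence `o(‖v‖)`; the mean value inequality supplies the second factor `‖v‖`.
  let F : X → Z := fun v => G (x + v) - G x - fderiv ℝ G x v - (1 / 2 : ℝ) • B v v
  have hF : ∀ v, HasFDerivAt F (fderiv ℝ G (x + v) - fderiv ℝ G x - B v) v := by
    intro v
    have h1 : HasFDerivAt (fun v => G (x + v)) (fderiv ℝ G (x + v)) v :=
      (hasFDerivAt_comp_add_left x).2 (hG1 (x + v)).hasFDerivAt
    have h2 : HasFDerivAt (fun v => B v v) (2 • B v) v := by
      refine (B.hasFDerivAt.clm_apply (hasFDerivAt_id v)).congr_fderiv ?_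
      ext w
      simp [hsymm w v, two_smul]
    refine (((h1.sub_const (G x)).sub (fderiv ℝ G x).hasFDerivAt).sub
      (h2.const_smul (1 / 2 : ℝ))).congr_fderiv ?_
    rw [← Nat.cast_smul_eq_nsmul ℝ, smul_smul]
    norm_num
  have hlo : (fun v => fderiv ℝ G (x + v) - fderiv ℝ G x - B v) =o[𝓝 0] fun v => v :=
    hasFDerivAt_iff_isLittleO_nhds_zero.1 (hG2 x).hasFDerivAt
  refine isLittleO_iff.2 fun ε hε => ?_
  obtain ⟨δ, hδ, hball⟩ := Metric.eventually_nhds_iff_ball.1 (isLittleO_iff.1 hlo hε)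
  filter_upwards [Metric.ball_mem_nhds (0 : X) hδ] with v hv
  have hsub : ∀ w ∈ Metric.closedBall (0 : X) ‖v‖, ‖w‖ ≤ ‖v‖ := fun w hw => by simpa using hw
  have := (convex_closedBall (0 : X) ‖v‖).norm_image_sub_le_of_norm_hasFDerivWithin_le
    (C := ε * ‖v‖) (fun w _ => (hF w).hasFDerivWithinAt) (fun w hw => ?_)
    (x := 0) (y := v) (by simp) (by simp)
  · have hF0 : F 0 = 0 := by simp [F]
    rw [hF0, sub_zero, sub_zero] at this
    rw [norm_pow, norm_norm, pow_two, ← mul_assoc]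
    exact this
  · refine (hball w ?_).trans (by gcongr; exact hsub w hw)
    rw [mem_ball_zero_iff] at hv ⊢
    exact (hsub w hw).trans_lt hv

/-- Expansion of `G` along the parabolic sequences `x + t h + t² r / 2`. -/
theorem exists_expansion {G : X → Z} (hG : ContDiff ℝ 2 G) (x h : X) {t : ℕ → ℝ} (ht : PosNull t)
    {r : ℕ → X} {M : ℝ} (hM : ∀ n, ‖t n • r n‖ ≤ M)
    (hB : Tendsto (fun n => fderiv ℝ (fderiv ℝ G) x (h + (1 / 2 : ℝ) • t n • r n)
      (h + (1 / 2 : ℝ) • t n • r n)) atTop (𝓝 (fderiv ℝ (fderiv ℝ G) x h h))) :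
    ∃ e : ℕ → Z, Tendsto e atTop (𝓝 0) ∧ ∀ n,
      G (x + t n • h + ((1 / 2 : ℝ) * t n ^ 2) • r n) = G x + t n • fderiv ℝ G x h +
        ((1 / 2 : ℝ) * t n ^ 2) • (fderiv ℝ G x (r n) + fderiv ℝ (fderiv ℝ G) x h h + e n) := by
  set A := fderiv ℝ G x
  set B := fderiv ℝ (fderiv ℝ G) x
  -- The parabola is `x + t n • u n` with `u` merely bounded: this already makes the Taylor
  -- remainder `o(t²)`, so norm convergence of `t n • r n` is not required.
  set u : ℕ → X := fun n => h + (1 / 2 : ℝ) • t n • r n with hu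
  let R : X → Z := fun v => G (x + v) - G x - A v - (1 / 2 : ℝ) • B v v
  have hub : ∀ n, ‖u n‖ ≤ ‖h‖ + 1 / 2 * M := fun n => by
    refine (norm_add_le _ _).trans ?_
    rw [norm_smul]
    have := hM n
    norm_num
    linarith
  have htu : Tendsto (fun n => t n • u n) atTop (𝓝 0) := by
    refine squeeze_zero_norm (a := fun n => |t n| * (‖h‖ + 1 / 2 * M)) (fun n => ?_)
      (by simpa using ht.2.abs.mul_const _)
    rw [norm_smul, Real.norm_eq_abs]
    exact mul_le_mul_of_nonneg_left (hub n) (abs_nonneg _)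
  have hR : (fun n => R (t n • u n)) =o[atTop] fun n => t n ^ 2 := by
    refine ((isLittleO_taylor_two hG x).comp_tendsto htu).trans_isBigO ?_
    refine IsBigO.of_bound ((‖h‖ + 1 / 2 * M) ^ 2) (Eventually.of_forall fun n => ?_)
    simp only [Function.comp, norm_smul, norm_pow, norm_mul, norm_norm, mul_pow]
    rw [mul_comm]
    gcongr
    exact hub n
  have hR' : Tendsto (fun n => (t n ^ 2)⁻¹ • R (t n • u n)) atTop (𝓝 0) :=
    hR.tendsto_inv_smul_nhds_zero
  refine ⟨fun n => (B (u n) (u n) - B h h) + (2 : ℝ) • (t n ^ 2)⁻¹ • R (t n • u n), ?_, fun n => ?_⟩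
  · simpa only [sub_self, smul_zero, add_zero] using
      (hB.sub_const (B h h)).add (hR'.const_smul (2 : ℝ))
  · have htn : t n ≠ 0 := (ht.1 n).ne'
    have h1 : x + t n • h + ((1 / 2 : ℝ) * t n ^ 2) • r n = x + t n • u n := by
      simp only [hu]; module
    have h2 : G (x + t n • u n) = G x + A (t n • u n) + (1 / 2 : ℝ) • B (t n • u n) (t n • u n)
        + R (t n • u n) := by simp only [R]; abel
    have h3 : R (t n • u n) = (t n ^ 2) • (t n ^ 2)⁻¹ • R (t n • u n) := by
      rw [smul_inv_smul₀ (pow_ne_zero 2 htn)]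
    have h4 : A (t n • u n) = t n • A h + ((1 / 2 : ℝ) * t n ^ 2) • A (r n) := by
      simp only [hu, map_smul, map_add]; module
    have h5 : B (t n • u n) (t n • u n) = (t n ^ 2) • B (u n) (u n) := by
      simp only [map_smul, smul_apply]; module
    rw [h1, h2, h3, h4, h5]
    module

/-- Almost nearest points, with slack `t n ^ 3 = o(t n ^ 2)`, replace the distance by an actual
sequence in `K`. -/
theorem mem_secondOrderTangentSet_iff {K : Set Z} (hK : K.Nonempty) {z h r : Z} :
    r ∈ secondOrderTangentSet K z h ↔ ∃ (t : ℕ → ℝ) (k : ℕ → Z), PosNull t ∧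
      (∀ᶠ n in atTop, k n ∈ K) ∧
      Tendsto (fun n => (t n ^ 2)⁻¹ • (z + t n • h + ((1 / 2 : ℝ) * t n ^ 2) • r - k n))
        atTop (𝓝 0) := by
  constructor
  · rintro ⟨t, ht, hlo⟩
    have hex : ∀ n, ∃ k ∈ K, dist (z + t n • h + ((1 / 2 : ℝ) * t n ^ 2) • r) k
        < Metric.infDist (z + t n • h + ((1 / 2 : ℝ) * t n ^ 2) • r) K + t n ^ 3 := fun n =>
      (Metric.infDist_lt_iff hK).1 (lt_add_of_pos_right _ (pow_pos (ht.1 n) 3))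
    choose k hkK hk using hex
    refine ⟨t, k, ht, Eventually.of_forall hkK, ?_⟩
    have hlim : Tendsto (fun n =>
        Metric.infDist (z + t n • h + ((1 / 2 : ℝ) * t n ^ 2) • r) K / t n ^ 2 + t n)
        atTop (𝓝 0) := by
      simpa using hlo.tendsto_div_nhds_zero.add ht.2
    refine squeeze_zero_norm (fun n => ?_) hlim
    have htn := ht.1 n
    rw [norm_smul, norm_inv, norm_pow, Real.norm_of_nonneg htn.le, ← dist_eq_norm,
      inv_mul_le_iff₀ (by positivity)]
    refine (hk n).le.trans (le_of_eq ?_)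
    field_simp
  · rintro ⟨t, k, ht, hkK, hlim⟩
    refine ⟨t, ht, (isLittleO_iff_tendsto fun n hn => absurd hn (pow_ne_zero 2 (ht.1 n).ne')).2 ?_⟩
    refine squeeze_zero' (Eventually.of_forall fun n =>
      div_nonneg Metric.infDist_nonneg (sq_nonneg _)) (hkK.mono fun n hn => ?_)
      (by simpa only [norm_zero] using hlim.norm)
    have htn := ht.1 n
    rw [norm_smul, norm_inv, norm_pow, Real.norm_of_nonneg htn.le, ← dist_eq_norm,
      div_eq_inv_mul]
    exact mul_le_mul_of_nonneg_left (Metric.infDist_le_dist_of_mem hn) (by positivity)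

/-- The second-order tangent set of a convex set absorbs feasible directions. -/
theorem add_sub_mem_secondOrderTangentSet {K : Set Z} (hK : Convex ℝ K) {z h r k : Z}
    (hr : r ∈ secondOrderTangentSet K z h) (hk : k ∈ K) :
    r + (k - z) ∈ secondOrderTangentSet K z h := by
  rw [mem_secondOrderTangentSet_iff ⟨k, hk⟩] at hr ⊢
  obtain ⟨t, κ, ht, hκ, hlim⟩ := hr
  have ht2 : Tendsto (fun n => t n ^ 2) atTop (𝓝 0) := by simpa using ht.2.pow 2
  -- Moving `κ n` towards `k` by the fraction `t² / 2` produces the extra `k - z` up to the scaled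
  -- error `(κ n - z) / 2`, which vanishes.
  refine ⟨t, fun n => κ n + ((1 / 2 : ℝ) * t n ^ 2) • (k - κ n), ht, ?_, ?_⟩
  · filter_upwards [hκ, ht2.eventually_le_const (show (0 : ℝ) < 1 by norm_num)] with n hn h1
    exact hK.add_smul_sub_mem hn hk ⟨by positivity, by linarith⟩
  · have hκz : Tendsto (fun n => κ n - z) atTop (𝓝 0) := by
      have h1 := ((ht.2.smul_const h).add ((ht2.const_mul (1 / 2 : ℝ)).smul_const r)).sub
        (ht2.smul hlim)
      simp only [mul_zero, zero_smul, add_zero, sub_zero] at h1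
      refine h1.congr fun n => ?_
      rw [smul_inv_smul₀ (pow_ne_zero 2 (ht.1 n).ne')]
      abel
    have h2 := hlim.add (hκz.const_smul (1 / 2 : ℝ))
    simp only [smul_zero, add_zero] at h2
    refine h2.congr fun n => ?_
    have h3 : (1 / 2 : ℝ) • (κ n - z)
        = (t n ^ 2)⁻¹ • (((1 / 2 : ℝ) * t n ^ 2) • (κ n - z)) := by
      rw [smul_smul]
      congr 1
      have := (ht.1 n).ne'
      field_simp
    rw [h3, ← smul_add]
    congr 1
    module

/-- The tangent cone of `G ⁻¹' K` contains the linearized cone. -/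
theorem mem_tangentCone_preimage {G : X → Z} {A : X →L[ℝ] Z} {x : X} (hG : HasFDerivAt G A x)
    {K : Set Z} {c : ℝ}
    (hreg : ∀ᶠ p : X × Z in 𝓝 (x, G x), p.2 ∈ K → ∃ u, G u ∈ K ∧ ‖u - p.1‖ ≤ c * ‖G p.1 - p.2‖)
    {h : X} (hh : A h ∈ tangentCone K (G x)) : h ∈ tangentCone (G ⁻¹' K) x := by
  obtain ⟨t, k, ht, hkK, hlim⟩ := hh
  have hp : Tendsto (fun n => x + t n • h) atTop (𝓝 x) := by
    simpa using (ht.2.smul_const h).const_add x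
  have hk : Tendsto k atTop (𝓝 (G x)) := by
    have h1 := (ht.2.smul hlim).const_add (G x)
    simp only [zero_smul, add_zero] at h1
    refine h1.congr fun n => ?_
    rw [smul_inv_smul₀ (ht.1 n).ne', add_sub_cancel]
  have hd : Tendsto (fun n => (t n)⁻¹ • (G (x + t n • h) - G x)) atTop (𝓝 (A h)) :=
    by simpa using hG.lim h (c := fun n => (t n)⁻¹) (l := atTop) (by
      refine tendsto_norm_atTop_atTop.comp (tendsto_inv_nhdsGT_zero.comp ?_)
      exact tendsto_nhdsWithin_iff.2 ⟨ht.2, Eventually.of_forall ht.1⟩)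
  have hres : Tendsto (fun n => (t n)⁻¹ • (G (x + t n • h) - k n)) atTop (𝓝 0) := by
    have h1 := hd.sub hlim
    rw [sub_self] at h1
    refine h1.congr fun n => ?_
    rw [← smul_sub]
    congr 1
    abel
  obtain ⟨q, hqK, hq⟩ := exists_seq_map_mem hreg hp (Eventually.of_forall hkK) hk hres
  -- Discarding the first `N` terms turns eventual feasibility into feasibility for all indices.
  obtain ⟨N, hN⟩ := eventually_atTop.1 hqK
  refine ⟨fun n => t (n + N), fun n => q (n + N),
    ⟨fun n => ht.1 _, (tendsto_add_atTop_iff_nat N).2 ht.2⟩, fun n => hN _ (Nat.le_add_left _ _), ?_⟩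
  refine (tendsto_add_atTop_iff_nat (f := fun n => (t n)⁻¹ • (q n - x)) N).2 ?_
  have h1 := hq.add_const h
  rw [zero_add] at h1
  refine h1.congr fun n => ?_
  have : h = (t n)⁻¹ • t n • h := by rw [inv_smul_smul₀ (ht.1 n).ne']
  nth_rw 2 [this]
  rw [← smul_add]
  congr 1
  abel

/-- Elements of the linearized second-order tangent set are limits of second-order feasible
sequences. -/
theorem exists_parabolic_seq {G : X → Z} (hG : ContDiff ℝ 2 G) {x : X} {K : Set Z}
    (hx : G x ∈ K) {c : ℝ}
    (hreg : ∀ᶠ p : X × Z in 𝓝 (x, G x), p.2 ∈ K → ∃ u, G u ∈ K ∧ ‖u - p.1‖ ≤ c * ‖G p.1 - p.2‖)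
    {h r : X} (hr : fderiv ℝ G x r + fderiv ℝ (fderiv ℝ G) x h h ∈
      secondOrderTangentSet K (G x) (fderiv ℝ G x h)) :
    ∃ (t : ℕ → ℝ) (ρ : ℕ → X), PosNull t ∧ Tendsto ρ atTop (𝓝 r) ∧
      ∀ n, x + t n • h + ((1 / 2 : ℝ) * t n ^ 2) • ρ n ∈ G ⁻¹' K := by
  obtain ⟨t, k, ht, hkK, hlim⟩ := (mem_secondOrderTangentSet_iff ⟨_, hx⟩).1 hr
  have ht2 : Tendsto (fun n => t n ^ 2) atTop (𝓝 0) := by simpa using ht.2.pow 2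
  have htr : Tendsto (fun n => t n • r) atTop (𝓝 0) := by simpa using ht.2.smul_const r
  obtain ⟨M, hM⟩ := htr.norm.bddAbove_range
  have hu : Tendsto (fun n => h + (1 / 2 : ℝ) • t n • r) atTop (𝓝 h) := by
    simpa using (htr.const_smul (1 / 2 : ℝ)).const_add h
  have hBc : Continuous fun v => fderiv ℝ (fderiv ℝ G) x v v := by fun_prop
  obtain ⟨e, he, hexp⟩ := exists_expansion hG x h ht (r := fun _ => r) (M := M)
    (fun n => hM ⟨n, rfl⟩) ((hBc.tendsto h).comp hu)
  have hp : Tendsto (fun n => x + t n • h + ((1 / 2 : ℝ) * t n ^ 2) • r) atTop (𝓝 x) := by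
    simpa using ((ht.2.smul_const h).const_add x).add ((ht2.const_mul (1 / 2 : ℝ)).smul_const r)
  have hres : Tendsto (fun n => (t n ^ 2)⁻¹ •
      (G (x + t n • h + ((1 / 2 : ℝ) * t n ^ 2) • r) - k n)) atTop (𝓝 0) := by
    have h1 := hlim.add (he.const_smul (1 / 2 : ℝ))
    simp only [smul_zero, add_zero] at h1
    refine h1.congr fun n => ?_
    have h3 : (1 / 2 : ℝ) • e n = (t n ^ 2)⁻¹ • (((1 / 2 : ℝ) * t n ^ 2) • e n) := by
      rw [smul_smul]
      congr 1
      have := (ht.1 n).ne'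
      field_simp
    rw [h3, ← smul_add, hexp]
    congr 1
    module
  have hk : Tendsto k atTop (𝓝 (G x)) := by
    have h1 := ((hG.continuous.tendsto x).comp hp).sub (ht2.smul hres)
    simp only [zero_smul, sub_zero] at h1
    refine h1.congr fun n => ?_
    simp [smul_inv_smul₀ (pow_ne_zero 2 (ht.1 n).ne')]
  obtain ⟨q, hqK, hq⟩ := exists_seq_map_mem hreg hp hkK hk hres
  obtain ⟨N, hN⟩ := eventually_atTop.1 hqK
  let p : ℕ → X := fun n => x + t n • h + ((1 / 2 : ℝ) * t n ^ 2) • r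
  refine ⟨fun n => t (n + N),
    -- Chosen so that the parabola passes exactly through the repaired point `q`.
    fun n => r + (2 : ℝ) • (t (n + N) ^ 2)⁻¹ • (q (n + N) - p (n + N)),
    ⟨fun n => ht.1 _, (tendsto_add_atTop_iff_nat N).2 ht.2⟩,
    ?_, fun n => ?_⟩
  · have h1 := (((tendsto_add_atTop_iff_nat N).2 hq).const_smul (2 : ℝ)).const_add r
    simpa only [smul_zero, add_zero] using h1
  · have h1 : x + t (n + N) • h + ((1 / 2 : ℝ) * t (n + N) ^ 2) •
        (r + (2 : ℝ) • (t (n + N) ^ 2)⁻¹ • (q (n + N) - p (n + N))) = q (n + N) := by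
      have h2 : ((1 / 2 : ℝ) * t (n + N) ^ 2) •
          ((2 : ℝ) • (t (n + N) ^ 2)⁻¹ • (q (n + N) - p (n + N)))
          = q (n + N) - p (n + N) := by
        rw [smul_smul, smul_smul]
        have := (ht.1 (n + N)).ne'
        rw [show 1 / 2 * t (n + N) ^ 2 * 2 * (t (n + N) ^ 2)⁻¹ = 1 by field_simp, one_smul]
      rw [smul_add, h2]
      simp only [p]
      abel
    rw [h1]
    exact hN _ (Nat.le_add_left _ _)

/-- Feasible parabolic sequences are asymptotically in the linearized second-order tangent set. -/
theorem exists_correction [CompleteSpace X] [CompleteSpace Z] {G : X → Z} (hG : ContDiff ℝ 2 G)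
    {x : X} {K : Set Z} (hKc : IsClosed K) (hK : Convex ℝ K) (hx : G x ∈ K)
    (hZK : Set.range (fderiv ℝ G x) - radialCone K (G x) = Set.univ)
    (hsor : IsSecondOrderRegularAt K (G x)) {h : X}
    (hh : fderiv ℝ G x h ∈ tangentCone K (G x)) {t : ℕ → ℝ} (ht : PosNull t) {r : ℕ → X} {M : ℝ}
    (hM : ∀ n, ‖t n • r n‖ ≤ M)
    (hA : Tendsto (fun n => fderiv ℝ G x (t n • r n)) atTop (𝓝 0))
    (hB : Tendsto (fun n => fderiv ℝ (fderiv ℝ G) x (h + (1 / 2 : ℝ) • t n • r n)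
      (h + (1 / 2 : ℝ) • t n • r n)) atTop (𝓝 (fderiv ℝ (fderiv ℝ G) x h h)))
    (hmem : ∀ n, x + t n • h + ((1 / 2 : ℝ) * t n ^ 2) • r n ∈ G ⁻¹' K) :
    ∃ d : ℕ → X, Tendsto d atTop (𝓝 0) ∧ ∀ᶠ n in atTop,
      fderiv ℝ G x (r n + d n) + fderiv ℝ (fderiv ℝ G) x h h ∈
        secondOrderTangentSet K (G x) (fderiv ℝ G x h) := by
  obtain ⟨e, he, hexp⟩ := exists_expansion hG x h ht hM hB
  obtain ⟨c, hc, δ, hδ, hopen⟩ := exists_add_map_add_mem hKc hK hx hZK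
  set A := fderiv ℝ G x
  set b := fderiv ℝ (fderiv ℝ G) x h h
  set S := secondOrderTangentSet K (G x) (A h)
  have hts : Tendsto (fun n => t n • (A (r n) + b + e n)) atTop (𝓝 0) := by
    have h1 := (hA.add (ht.2.smul_const b)).add (ht.2.smul he)
    simpa only [map_smul, zero_smul, add_zero, ← smul_add] using h1
  -- Regularity applies to the image parabola, whose second-order part is `A (r n) + b + e n`.
  -- Convergence to `0` also forces `S` to be nonempty.
  have hdist : Tendsto (fun n => Metric.infEDist (A (r n) + b + e n) S) atTop (𝓝 0) :=
    hsor (A h) hh t _ ht hts fun n => by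
      rw [← hexp n]
      exact hmem n
  have hex : ∀ᶠ n in atTop, ∃ σ, σ ∈ S ∧ edist (A (r n) + b + e n) σ <
      Metric.infEDist (A (r n) + b + e n) S + ENNReal.ofReal (t n) := by
    filter_upwards [hdist.eventually_lt_const ENNReal.zero_lt_top] with n hn
    exact Metric.infEDist_lt_iff.1 (ENNReal.lt_add_right hn.ne
      (ENNReal.ofReal_pos.2 (ht.1 n)).ne')
  obtain ⟨σ, hσ⟩ := hex.choice
  have hσlim : Tendsto (fun n => A (r n) + b + e n - σ n) atTop (𝓝 0) := by
    have hof : Tendsto (fun n => ENNReal.ofReal (t n)) atTop (𝓝 0) := by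
      simpa using ENNReal.tendsto_ofReal ht.2
    rw [tendsto_iff_edist_tendsto_0]
    refine tendsto_of_tendsto_of_tendsto_of_le_of_le' tendsto_const_nhds
      (by simpa using hdist.add hof) (Eventually.of_forall fun _ => zero_le)
      (hσ.mono fun n hn => ?_)
    rw [edist_zero_right, ← edist_eq_enorm_sub]
    exact hn.2.le
  have hy : Tendsto (fun n => A (r n) + b - σ n) atTop (𝓝 0) := by
    have h1 := hσlim.sub he
    rw [sub_zero] at h1
    exact h1.congr fun n => by abel
  have hexd : ∀ᶠ n in atTop, ∃ d, ‖d‖ ≤ c * ‖A (r n) + b - σ n‖ ∧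
      G x + (A d + (A (r n) + b - σ n)) ∈ K := by
    filter_upwards [(tendsto_zero_iff_norm_tendsto_zero.1 hy).eventually_le_const hδ] with n hn
    exact hopen _ hn
  obtain ⟨d, hd⟩ := hexd.choice
  refine ⟨d, squeeze_zero_norm' (hd.mono fun n hn => hn.1) (by simpa using hy.norm.const_mul c), ?_⟩
  filter_upwards [hd, hσ] with n hdn hσn
  -- With `k - G x = A d + (A r + b - σ)`, the sum `σ + (k - G x)` is exactly `A (r + d) + b`;
  -- surjectivity of `A` alone is not needed because `S` absorbs `K - G x`.
  have h1 := add_sub_mem_secondOrderTangentSet hK hσn.1 hdn.2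
  convert h1 using 1
  rw [map_add]
  abel

/-- First-order expansion along bounded difference quotients. -/
theorem tendsto_difference_quotient {G : X → Z} {A : X →L[ℝ] Z} {x : X} (hG : HasFDerivAt G A x)
    {t : ℕ → ℝ} (ht : PosNull t) {u : ℕ → X} {M : ℝ} (hM : ∀ n, ‖(t n)⁻¹ • (u n - x)‖ ≤ M) {b : Z}
    (hA : Tendsto (fun n => A ((t n)⁻¹ • (u n - x))) atTop (𝓝 b)) :
    Tendsto (fun n => (t n)⁻¹ • (G (u n) - G x)) atTop (𝓝 b) := by
  have hle : ∀ n, ‖u n - x‖ ≤ M * ‖t n‖ := fun n => by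
    have := hM n
    rwa [norm_smul, norm_inv, inv_mul_le_iff₀ (norm_pos_iff.2 (ht.1 n).ne'), mul_comm] at this
  have hO : (fun n => u n - x) =O[atTop] t := IsBigO.of_bound M (Eventually.of_forall hle)
  have hu : Tendsto u atTop (𝓝 x) :=
    tendsto_sub_nhds_zero_iff.1 (hO.trans_tendsto ht.2)
  have h1 := ((hG.isLittleO.comp_tendsto hu).trans_isBigO hO).tendsto_inv_smul_nhds_zero.add hA
  rw [zero_add] at h1
  refine h1.congr fun n => ?_
  simp only [Function.comp, map_smul, ← smul_add]
  congr 1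
  abel

end Expansion

/-! ### Weak-* limits and extended-real limits. -/

section WeakStarLimits

variable {Y : Type*} [NormedAddCommGroup Y] [NormedSpace ℝ Y]

/-- Uniform boundedness on the complete space `Y`; the bound controls Taylor remainders along
sequences that converge only weak-*. -/
theorem WeakStarTendsto.exists_norm_le [CompleteSpace Y] {u : ℕ → StrongDual ℝ Y}
    {a : StrongDual ℝ Y} (hu : WeakStarTendsto u a) : ∃ M, ∀ n, ‖u n‖ ≤ M := by
  refine banach_steinhaus fun y => ?_
  have h1 : Tendsto (fun n => u n y) atTop (𝓝 (a y)) :=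
    tendsto_iff_forall_eval_tendsto_topDualPairing.1 hu y
  obtain ⟨M, hM⟩ := h1.norm.bddAbove_range
  exact ⟨M, fun n => hM ⟨n, rfl⟩⟩

theorem weakStarTendsto_of_tendsto {u : ℕ → StrongDual ℝ Y} {a : StrongDual ℝ Y}
    (hu : Tendsto u atTop (𝓝 a)) : WeakStarTendsto u a :=
  (NormedSpace.Dual.toWeakDual_continuous.tendsto a).comp hu

theorem tangentCone_subset_weakStarTangentCone (C : Set (StrongDual ℝ Y)) (x : StrongDual ℝ Y) :
    tangentCone C x ⊆ weakStarTangentCone C x := fun _ ⟨t, u, ht, hu, hlim⟩ =>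
  ⟨t, u, ht, hu, weakStarTendsto_of_tendsto hlim⟩

theorem WeakStarTendsto.add_const_smul {u : ℕ → StrongDual ℝ Y} (hu : WeakStarTendsto u 0)
    (h : StrongDual ℝ Y) (c : ℝ) : WeakStarTendsto (fun n => h + c • u n) h := by
  have h1 := (Tendsto.const_smul hu c).const_add (StrongDual.toWeakDual h)
  simpa only [WeakStarTendsto, map_add, map_smul, map_zero, smul_zero, add_zero] using h1

/-- Perturbing a real sequence by a null sequence does not destroy lower bounds on its lower
limit. -/
theorem le_liminf_of_eventually_le_add {a b : ℕ → ℝ} {m : EReal} (hb : Tendsto b atTop (𝓝 0))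
    (h : ∀ᶠ n in atTop, m ≤ ((a n + b n : ℝ) : EReal)) :
    m ≤ liminf (fun n => (a n : EReal)) atTop := by
  have hb' : Tendsto (fun n => ((-b n : ℝ) : EReal)) atTop (𝓝 0) := by
    have := (continuous_coe_real_ereal.tendsto (-0 : ℝ)).comp hb.neg
    rwa [neg_zero, EReal.coe_zero] at this
  -- `m` may be infinite; addition is still continuous at `(m, 0)`, as no `∞ - ∞` occurs.
  have hlim : Tendsto (fun n => m + ((-b n : ℝ) : EReal)) atTop (𝓝 m) := by
    have h1 := (EReal.continuousAt_add (p := (m, 0)) (by simp) (by simp)).tendsto.comp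
      ((tendsto_const_nhds (x := m)).prodMk_nhds hb')
    rwa [add_zero] at h1
  rw [← hlim.liminf_eq]
  refine liminf_le_liminf (h.mono fun n hn => ?_)
  refine (add_le_add_left hn _).trans (le_of_eq ?_)
  rw [← EReal.coe_add]
  congr 1
  ring

end WeakStarLimits

/-- A diagonal argument: the curvature functional is attained by a norm sequence as soon as it is
the infimum of `φ` over a nonempty set of norm limits of second-order feasible sequences. -/
theorem exists_seq_tendsto_iInf {X : Type*} [NormedAddCommGroup X] [NormedSpace ℝ X]
    {C : Set X} {x h : X} {φ : StrongDual ℝ X} {R : Set X} (hR : R.Nonempty)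
    (hC : ∀ r ∈ R, ∃ (t : ℕ → ℝ) (ρ : ℕ → X), PosNull t ∧ Tendsto ρ atTop (𝓝 r) ∧
      ∀ n, x + t n • h + ((1 / 2 : ℝ) * t n ^ 2) • ρ n ∈ C) :
    ∃ (r : ℕ → X) (t : ℕ → ℝ), PosNull t ∧ Tendsto (fun k => t k • r k) atTop (𝓝 0) ∧
      (∀ k, x + t k • h + ((1 / 2 : ℝ) * t k ^ 2) • r k ∈ C) ∧
      Tendsto (fun k => ((φ (r k) : ℝ) : EReal)) atTop (𝓝 (⨅ r ∈ R, ((φ r : ℝ) : EReal))) := by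
  obtain ⟨v, -, hv, hvR⟩ := exists_seq_tendsto_sInf (S := (fun r => ((φ r : ℝ) : EReal)) '' R)
    (hR.image _) (OrderBot.bddBelow _)
  rw [sInf_image] at hv
  choose r' hr'R hr' using hvR
  -- For each member of a minimizing sequence, one term far along its approximating parabola is
  -- kept.
  have hstep : ∀ j : ℕ, ∃ (t : ℝ) (r : X), 0 < t ∧ t < 1 / ((j : ℝ) + 1) ∧
      ‖r - r' j‖ < 1 / ((j : ℝ) + 1) ∧ ‖t • r‖ < 1 / ((j : ℝ) + 1) ∧
      x + t • h + ((1 / 2 : ℝ) * t ^ 2) • r ∈ C := by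
    intro j
    obtain ⟨t, ρ, ht, hρ, hmem⟩ := hC _ (hr'R j)
    have hj : (0 : ℝ) < 1 / ((j : ℝ) + 1) := by positivity
    have h1 := ht.2.eventually_lt_const hj
    have h2 := (tendsto_iff_norm_sub_tendsto_zero.1 hρ).eventually_lt_const hj
    have h3 : Tendsto (fun n => ‖t n • ρ n‖) atTop (𝓝 0) := by simpa using (ht.2.smul hρ).norm
    obtain ⟨n, ⟨hn1, hn2⟩, hn3⟩ := ((h1.and h2).and (h3.eventually_lt_const hj)).exists
    exact ⟨t n, ρ n, ht.1 n, hn1, hn2, hn3, hmem n⟩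
  choose t r ht0 ht1 hr1 htr hmem using hstep
  have hone : Tendsto (fun j : ℕ => 1 / ((j : ℝ) + 1)) atTop (𝓝 0) :=
    tendsto_one_div_add_atTop_nhds_zero_nat
  refine ⟨r, t, ⟨ht0, squeeze_zero (fun j => (ht0 j).le) (fun j => (ht1 j).le) hone⟩,
    squeeze_zero_norm (fun j => (htr j).le) hone, hmem, ?_⟩
  have hd : Tendsto (fun j => r j - r' j) atTop (𝓝 0) :=
    squeeze_zero_norm (fun j => (hr1 j).le) hone
  have hφd : Tendsto (fun j => ((φ (r j - r' j) : ℝ) : EReal)) atTop (𝓝 0) := by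
    have := (continuous_coe_real_ereal.tendsto _).comp ((φ.continuous.tendsto 0).comp hd)
    rwa [map_zero, EReal.coe_zero] at this
  have h1 := (EReal.continuousAt_add (p := (⨅ r ∈ R, ((φ r : ℝ) : EReal), 0)) (by simp)
    (by simp)).tendsto.comp (hv.prodMk_nhds hφd)
  simp only [add_zero] at h1
  refine h1.congr fun j => ?_
  simp only [Function.comp, ← hr', ← EReal.coe_add, map_sub, add_sub_cancel]

/-- A tangent direction admits a parabolic sequence with second-order part of order `o(1 / t)`. -/
theorem exists_parabolic_of_mem_tangentCone {X : Type*} [NormedAddCommGroup X] [NormedSpace ℝ X]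
    {C : Set X} {x h : X} (hh : h ∈ tangentCone C x) :
    ∃ (t : ℕ → ℝ) (r : ℕ → X), PosNull t ∧ Tendsto (fun n => t n • r n) atTop (𝓝 0) ∧
      ∀ n, x + t n • h + ((1 / 2 : ℝ) * t n ^ 2) • r n ∈ C := by
  obtain ⟨t, u, ht, hu, hlim⟩ := hh
  refine ⟨t, fun n => ((2 : ℝ) * (t n ^ 2)⁻¹) • (u n - x - t n • h), ht, ?_, fun n => ?_⟩
  · have h1 := (hlim.sub_const h).const_smul (2 : ℝ)
    rw [sub_self, smul_zero] at h1
    refine h1.congr fun n => ?_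
    have htn := (ht.1 n).ne'
    have : h = (t n)⁻¹ • t n • h := by rw [inv_smul_smul₀ htn]
    nth_rw 1 [this]
    rw [← smul_sub, smul_smul, smul_smul]
    congr 1
    field_simp
  · have htn := (ht.1 n).ne'
    rw [smul_smul, show 1 / 2 * t n ^ 2 * (2 * (t n ^ 2)⁻¹) = 1 by field_simp, one_smul]
    convert hu n using 1
    abel

end DirCurv

/-! ### The three assertions of the lemma. -/

theorem mainTheorem10
    {Y : Type*} [NormedAddCommGroup Y] [NormedSpace ℝ Y] [CompleteSpace Y]
    [TopologicalSpace.SeparableSpace Y]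
    {Z : Type*} [NormedAddCommGroup Z] [NormedSpace ℝ Z] [CompleteSpace Z]
    (G : StrongDual ℝ Y → Z) (hG : ContDiff ℝ 2 G)
    (K : Set Z) (hKclosed : IsClosed K) (hKconvex : Convex ℝ K) (hKne : K.Nonempty)
    (C : Set (StrongDual ℝ Y)) (hC : C = G ⁻¹' K)
    (x : StrongDual ℝ Y) (hx : x ∈ C)
    (φ : StrongDual ℝ (StrongDual ℝ Y)) (hφ : φ ∈ -DirCurv.weakStarNormalCone C x)
    (hZK : Set.range (fderiv ℝ G x) - DirCurv.radialCone K (G x) = Set.univ)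
    (hK : DirCurv.IsSecondOrderRegularAt K (G x))
    (hG₁ : SeqContinuous fun h : WeakDual ℝ Y => fderiv ℝ G x (WeakDual.toStrongDual h))
    (hG₂ : SeqContinuous fun h : WeakDual ℝ Y =>
      fderiv ℝ (fderiv ℝ G) x (WeakDual.toStrongDual h) (WeakDual.toStrongDual h)) :
    DirCurv.MoscoRegular C x φ ∧
    DirCurv.weakStarCriticalCone C x φ =
      {h | φ h = 0} ∩ fderiv ℝ G x ⁻¹' DirCurv.tangentCone K (G x) ∧
    ∀ h ∈ DirCurv.weakStarCriticalCone C x φ,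
      DirCurv.curvatureFunctional C x φ h =
        ⨅ r ∈ fderiv ℝ G x ⁻¹'
            (DirCurv.secondOrderTangentSet K (G x) (fderiv ℝ G x h)
              - {fderiv ℝ (fderiv ℝ G) x h h}),
          ((φ r : ℝ) : EReal) := by
  subst hC
  have hstrict : HasStrictFDerivAt G (fderiv ℝ G x) x :=
    hG.contDiffAt.hasStrictFDerivAt (by norm_num)
  obtain ⟨c, hc, hreg⟩ := DirCurv.exists_metricRegular hG.continuous hstrict hKclosed hKconvex hx hZK
  have hlin : ∀ h ∈ DirCurv.weakStarTangentCone (G ⁻¹' K) x,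
      fderiv ℝ G x h ∈ DirCurv.tangentCone K (G x) := by
    rintro h ⟨t, u, ht, hu, hlim⟩
    obtain ⟨M, hM⟩ := hlim.exists_norm_le
    exact ⟨t, fun n => G (u n), ht, hu,
      DirCurv.tendsto_difference_quotient hstrict.hasFDerivAt ht hM (hG₁ hlim)⟩
  have htan : ∀ h, fderiv ℝ G x h ∈ DirCurv.tangentCone K (G x) →
      h ∈ DirCurv.tangentCone (G ⁻¹' K) x := fun h hh =>
    DirCurv.mem_tangentCone_preimage hstrict.hasFDerivAt hreg hh
  let R : StrongDual ℝ Y → Set (StrongDual ℝ Y) := fun h => fderiv ℝ G x ⁻¹'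
    (DirCurv.secondOrderTangentSet K (G x) (fderiv ℝ G x h) - {fderiv ℝ (fderiv ℝ G) x h h})
  have hR : ∀ h r, r ∈ R h ↔ fderiv ℝ G x r + fderiv ℝ (fderiv ℝ G) x h h ∈
      DirCurv.secondOrderTangentSet K (G x) (fderiv ℝ G x h) := fun h r => by
    simp [R, Set.sub_singleton, sub_eq_iff_eq_add]
  have hlow : ∀ h ∈ DirCurv.weakStarTangentCone (G ⁻¹' K) x,
      ∀ (t : ℕ → ℝ) (r : ℕ → StrongDual ℝ Y), DirCurv.PosNull t →
      DirCurv.WeakStarTendsto (fun n => t n • r n) 0 →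
      (∀ n, x + t n • h + ((1 / 2 : ℝ) * t n ^ 2) • r n ∈ G ⁻¹' K) →
      ∃ d : ℕ → StrongDual ℝ Y, Tendsto d atTop (𝓝 0) ∧ ∀ᶠ n in atTop, r n + d n ∈ R h := by
    intro h hh t r ht htr hmem
    obtain ⟨M, hM⟩ := htr.exists_norm_le
    simp only [hR]
    refine DirCurv.exists_correction hG hKclosed hKconvex hx hZK hK (hlin h hh) ht hM ?_
      (hG₂ (htr.add_const_smul h (1 / 2))) hmem
    exact map_zero (fderiv ℝ G x) ▸ hG₁ htr
  have hup : ∀ h, ∀ r ∈ R h, ∃ (t : ℕ → ℝ) (ρ : ℕ → StrongDual ℝ Y), DirCurv.PosNull t ∧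
      Tendsto ρ atTop (𝓝 r) ∧ ∀ n, x + t n • h + ((1 / 2 : ℝ) * t n ^ 2) • ρ n ∈ G ⁻¹' K :=
    fun h r hr => DirCurv.exists_parabolic_seq hG hx hreg ((hR h r).1 hr)
  -- The diagonal argument needs a nonempty `R h`: a weak-* tangent direction is also a strong one,
  -- and correcting its parabolic sequence yields an element.
  have hne : ∀ h ∈ DirCurv.weakStarTangentCone (G ⁻¹' K) x, (R h).Nonempty := by
    intro h hh
    obtain ⟨t, r, ht, htr, hmem⟩ :=
      DirCurv.exists_parabolic_of_mem_tangentCone (htan h (hlin h hh))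
    obtain ⟨d, -, hd⟩ := hlow h hh t r ht (DirCurv.weakStarTendsto_of_tendsto htr) hmem
    obtain ⟨n, hn⟩ := hd.exists
    exact ⟨_, hn⟩
  have hQ : ∀ h ∈ DirCurv.weakStarCriticalCone (G ⁻¹' K) x φ,
      DirCurv.curvatureFunctional (G ⁻¹' K) x φ h = ⨅ r ∈ R h, ((φ r : ℝ) : EReal) := by
    intro h hh
    refine le_antisymm (le_iInf₂ fun r hr => ?_) (le_sInf ?_)
    · obtain ⟨t, ρ, ht, hρ, hmem⟩ := hup h r hr
      refine sInf_le ⟨ρ, t, ht, DirCurv.weakStarTendsto_of_tendsto ?_, hmem, ?_⟩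
      · simpa using ht.2.smul hρ
      · exact (((continuous_coe_real_ereal.tendsto _).comp
          ((φ.continuous.tendsto r).comp hρ)).liminf_eq).symm
    · rintro _ ⟨r, t, ht, htr, hmem, rfl⟩
      obtain ⟨d, hd, hdR⟩ := hlow h hh.1 t r ht htr hmem
      -- The correction `d` is null in norm, so `φ (d n)` does not affect the lower limit.
      refine DirCurv.le_liminf_of_eventually_le_add (b := fun n => φ (d n))
        (map_zero φ ▸ (φ.continuous.tendsto 0).comp hd) (hdR.mono fun n hn => ?_)
      rw [← map_add]
      exact iInf₂_le _ hn
  refine ⟨fun h hh => ?_, ?_, hQ⟩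
  · rw [hQ h hh]
    exact DirCurv.exists_seq_tendsto_iInf (hne h hh.1) (hup h)
  · ext h
    exact ⟨fun hh => ⟨hh.2, hlin h hh.1⟩, fun hh =>
      ⟨DirCurv.tangentCone_subset_weakStarTangentCone _ _ (htan h hh.2), hh.1⟩⟩
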